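/- Let $\sigma$ be a finite relational vocabulary; all structures are finite, and the empty structure is allowed. For $n\ge 0$ let $\sigma_n$ be $\sigma$ with $n$ added constant symbols. Homomorphisms preserve relations and constants. Let $L$ be $\sigma$ or $\sigma_n$. **Definitions.** The Gaifman graph of a structure joins two distinct elements that occur in a common related tuple. A graph has tree-depth $\le k$ if it is contained in the closure of a rooted forest of height $\le k$, height being counted in vertices. For a tuple $\vec c$ in an $L$-structure $\mathfrak C$, the tree-depth of $(\mathfrak C,\vec c)$ is that of its Gaifman graph after deletion of all elements named by constant symbols or occurring in $\vec c$. Write $(\mathfrak A,\vec a)\rightleftarrows^{k}(\mathfrak B,\vec b)$ if every $(\mathfrak C,\vec c)$ of tree-depth $\le k$ has a homomorphism to $\mathfrak A$ carrying $\vec c$ to $\vec a$ if and only if it has a homomorphism to $\mathfrak B$ carrying $\vec c$ to $\vec b$. *$k$-homotopic equivalence* $\mathfrak A\sim_k\mathfrak B$ means $\mathfrak A\rightleftarrows^k\mathfrak B$ (with empty tuples). $\mathfrak A\equiv_k\mathfrak B$ means that $\mathfrak A$ and $\mathfrak B$ satisfy the same first-order sentences of quantifier rank $\le k$. For a class $\mathcal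 K$ of $L$-structures, $\mathfrak A$ is *$k$-extendable in $\mathcal K$* if, for every $m<k$, every $\mathfrak B\in\mathcal K$ and all $m$-tuples $\vec x$ in $\mathfrak A$ and $\vec y$ in $\mathfrak B$ with pairwise distinct entries and $(\mathfrak A,\vec x)\rightleftarrows^{k-m}(\mathfrak B,\vec y)$, each $b\in B$ has an $a\in A$ with $(\mathfrak A,\vec xa)\rightleftarrows^{k-m-1}(\mathfrak B,\vec yb)$. For a $\sigma$-structure $\mathfrak A$ and $\vec a\in A^n$, $N_d^{\mathfrak A}(\vec a)$ is the $\sigma_n$-structure induced on the elements at Gaifman distance $\le d$ from some $a_i$, with constants $\vec a$. **Claim.** Let $n,d\ge 0$, and let $\mathbf C$ be one of the following categories (with all homomorphisms), with $\mathcal K$ its class of objects: 1. the $\sigma_n$-structures isomorphic to some $N_d^{\mathfrak A}(\vec a)$, with $\mathfrak A$ a $\sigma$-structure and $\vec a\in A^n$; 2. all $\sigma$-structures; 3. all $\sigma_n$-structures. Then there is a Quillen model structure $\mathbb M$ on $\mathbf C$ in which all objects are fibrant and cofibrant, the acyclic fibrations are exactly the retractions (split epimorphisms), and for every morphism $f\colon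 X\to Y$ the following are equivalent: $f$ is a homotopy equivalence in $\mathbb M$; $f$ is a weak equivalence; $f$ is a homomorphic equivalence, i.e. there is also a morphism $Y\to X$. Two objects $X,Y$ of $\mathbf C$ are homotopy equivalent in $\mathbb M$ if and only if $X\sim_kY$ for all $k$. Moreover, for every $k\ge 0$ and all $X,Y$ in $\mathbf C$ that are $k$-extendable in $\mathcal K$, $$X\sim_k Y\iff X\equiv_k Y,$$ where $\equiv_k$ refers to all first-order sentences of quantifier rank $\le k$, not only primitive-positive ones. In case 1 the objects are, up to isomorphism, neighborhoods $N_d^{\mathfrak A}(\vec a)$, so the equivalence reads: if $N_d^{\mathfrak A}(\vec a)$ and $N_d^{\mathfrak B}(\vec b)$ are $k$-extendable in $\mathcal K$, then $N_d^{\mathfrak A}(\vec a)\sim_kN_d^{\mathfrak B}(\vec b)\iff N_d^{\mathfrak A}(\vec a)\equiv_kN_d^{\mathfrak B}(\vec b)$. -/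

import Mathlib

open CategoryTheory HomotopicalAlgebra
open FirstOrder

namespace FMT

universe u v

/-! ### The category of finite structures and homomorphisms -/

/-- A finite `L`-structure. The universe of a structure may be empty. -/
structure FinStruct (L : FirstOrder.Language.{u, v}) where
  carrier : Type
  [str : L.Structure carrier]
  [fin : Finite carrier]

namespace FinStruct

variable {L : FirstOrder.Language.{u, v}}

instance : CoeSort (FinStruct L) Type := ⟨FinStruct.carrier⟩

instance (A : FinStruct L) : L.Structure A := A.str

instance (A : FinStruct L) : Finite A := A.fin

/-- `STRUCT[L]`: finite `L`-structures and their homomorphisms. -/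
instance : Category (FinStruct L) where
  Hom A B := A →[L] B
  id A := FirstOrder.Language.Hom.id L A
  comp f g := g.comp f

end FinStruct

/-! ### First-order equivalence up to quantifier rank `k` -/

/-- The quantifier rank (maximal nesting depth of quantifiers) of a first-order formula. -/
def quantifierRank {L : FirstOrder.Language.{u, v}} {α : Type} :
    {n : ℕ} → L.BoundedFormula α n → ℕ
  | _, .falsum => 0
  | _, .equal _ _ => 0
  | _, .rel _ _ => 0
  | _, .imp φ ψ => max (quantifierRank φ) (quantifierRank ψ)
  | _, .all φ => quantifierRank φ + 1

/-- `A ≡ₖ B`: the structures agree on all first-order sentences of quantifier rank up to `k`. -/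
def LogicallyEquivalent {L : FirstOrder.Language.{u, v}} (k : ℕ) (A B : FinStruct L) : Prop :=
  ∀ φ : L.Sentence, quantifierRank φ ≤ k → (A ⊨ φ ↔ B ⊨ φ)

/-! ### Gaifman graphs, neighbourhoods and tree-depth -/

/-- The Gaifman graph: distinct elements are adjacent if they occur in a common related tuple. -/
def gaifmanGraph {L : FirstOrder.Language.{u, v}} (A : Type) [L.Structure A] : SimpleGraph A where
  Adj x y := x ≠ y ∧ ∃ (p : ℕ) (R : L.Relations p) (c : Fin p → A),
    FirstOrder.Language.Structure.RelMap R c ∧ x ∈ Set.range c ∧ y ∈ Set.range c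
  symm := ⟨fun _ _ ⟨hne, p, R, c, hc, hx, hy⟩ => ⟨hne.symm, p, R, c, hc, hy, hx⟩⟩
  loopless := ⟨fun _ h => h.1 rfl⟩

/-- The `r`-ball around a tuple: the elements at distance at most `r` from some entry of it. -/
def ball {L : FirstOrder.Language.{u, v}} (A : FinStruct L) (r : ℕ) {n : ℕ} (a : Fin n → A) : Set A :=
  {b | ∃ i, (gaifmanGraph (L := L) A).edist (a i) b ≤ r}

theorem mem_ball {L : FirstOrder.Language.{u, v}} (A : FinStruct L) (r : ℕ) {n : ℕ} (a : Fin n → A)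
    (i : Fin n) : a i ∈ ball A r a :=
  ⟨i, by simp⟩

/-- The `r`-neighbourhood of `a = (a₁, …, aₙ)`: the substructure induced on the `r`-ball, with
the `n` new constant symbols interpreted by `a₁, …, aₙ`. -/
def neighborhood {σ : FirstOrder.Language.{u, v}} [σ.IsRelational] (A : FinStruct σ) (r : ℕ) {n : ℕ}
    (a : Fin n → A) : FinStruct (σ.withConstants (Fin n)) :=
  letI : σ.Structure (ball A r a) :=
    { funMap := fun f _ => isEmptyElim f
      RelMap := fun R c => FirstOrder.Language.Structure.RelMap R (fun i => (c i : A)) }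
  letI : (FirstOrder.Language.constantsOn (Fin n)).Structure (ball A r a) :=
    FirstOrder.Language.constantsOn.structure (fun i => ⟨a i, mem_ball A r a i⟩)
  { carrier := ball A r a }

/-- The `σₙ`-structures that are, up to isomorphism, `d`-neighbourhoods of `n`-tuples in finite
`σ`-structures. The full subcategory of these is the category of `d`-neighbourhoods. -/
def neighborhoods (σ : FirstOrder.Language.{u, v}) [σ.IsRelational] (n d : ℕ) :
    ObjectProperty (FinStruct (σ.withConstants (Fin n))) :=
  fun N => ∃ (A : FinStruct σ) (a : Fin n → A), Nonempty (N ≅ neighborhood A d a)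

/-- The graph `G` has tree-depth at most `k`: there is a rooted forest of height at most `k`
(counted in vertices) whose closure contains `G`. The forest is given by its ancestor order, in
which the ancestors of a vertex form a chain. -/
def TreeDepthLE {V : Type} (G : SimpleGraph V) (k : ℕ) : Prop :=
  ∃ r : PartialOrder V,
    (∀ x y z, r.le y x → r.le z x → r.le y z ∨ r.le z y) ∧
    (∀ x, {y | r.le y x}.ncard ≤ k) ∧
    ∀ x y, G.Adj x y → r.le x y ∨ r.le y x

/-- The elements of a structure that are neither named by a constant symbol nor listed in the
tuple `c`. -/
def unnamed {L : FirstOrder.Language.{u, v}} (C : FinStruct L) {m : ℕ} (c : Fin m → C) : Set C :=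
  {x | (∀ s : L.Constants, (s : C) ≠ x) ∧ x ∉ Set.range c}

/-! ### `k`-homomorphisms, `k`-homotopic equivalence, `k`-extendability -/

/-- `(A, a) →ᵏ (B, b)`: every finite `(C, c)` of tree-depth at most `k` over its distinguished
elements (those named by constant symbols or by `c`) that maps homomorphically to `(A, a)` also
maps homomorphically to `(B, b)`. -/
def KHomTo {L : FirstOrder.Language.{u, v}} (k : ℕ) {m : ℕ} (A : FinStruct L) (a : Fin m → A)
    (B : FinStruct L) (b : Fin m → B) : Prop :=
  ∀ (C : FinStruct L) (c : Fin m → C),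
    TreeDepthLE ((gaifmanGraph (L := L) C).induce (unnamed C c)) k →
    (∃ f : C →[L] A, ∀ i, f (c i) = a i) → ∃ g : C →[L] B, ∀ i, g (c i) = b i

/-- `(A, a) ⇄ᵏ (B, b)`: `k`-homomorphisms exist in both directions. -/
def KHomEquiv {L : FirstOrder.Language.{u, v}} (k : ℕ) {m : ℕ} (A : FinStruct L) (a : Fin m → A)
    (B : FinStruct L) (b : Fin m → B) : Prop :=
  KHomTo k A a B b ∧ KHomTo k B b A a

/-- `A ∼ₖ B`, `k`-homotopic equivalence: `A` and `B` are `k`-homomorphically equivalent. -/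
def KHomotopic {L : FirstOrder.Language.{u, v}} (k : ℕ) (A B : FinStruct L) : Prop :=
  KHomEquiv k A Fin.elim0 B Fin.elim0

/-- `A` is `k`-extendable with respect to the class `P` of structures: for every set
`X = {x₁, …, xₘ}` of `m < k` elements of `A` and every `B` in `P` that contains `X` (as
`{y₁, …, yₘ}`) with `A ⇄ᵏ⁻ᵐ B` over `X`, every `b` in `B` has an `a` in `A` with
`(A, a) ⇄ᵏ⁻ᵐ⁻¹ (B, b)` over `X`. -/
def IsExtendable {L : FirstOrder.Language.{u, v}} (P : ObjectProperty (FinStruct L)) (k : ℕ)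
    (A : FinStruct L) : Prop :=
  ∀ (m : ℕ) (x : Fin m → A), m < k → Function.Injective x →
    ∀ (B : FinStruct L) (y : Fin m → B), P B → Function.Injective y →
      KHomEquiv (k - m) A x B y →
      ∀ b : B, ∃ a : A,
        KHomEquiv (k - m - 1) A (Fin.snoc x a : Fin (m + 1) → A)
          B (Fin.snoc y b : Fin (m + 1) → B)

/-- Extendability with respect to all finite structures is the strongest instance. -/
theorem IsExtendable.of_top {L : FirstOrder.Language.{u, v}} (P : ObjectProperty (FinStruct L)) {k : ℕ}
    {A : FinStruct L} (h : IsExtendable ⊤ k A) : IsExtendable P k A :=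
  fun m x hm hx B y _ hy => h m x hm hx B y trivial hy

/-! ### The model structure -/

section Model

variable {C : Type*} [Category C] [ModelCategory C]

/-- Parallel morphisms are homotopic if they are both left and right homotopic. -/
def Homotopic {X Y : C} (f g : X ⟶ Y) : Prop :=
  LeftHomotopyRel f g ∧ RightHomotopyRel f g

/-- Homotopy equivalences of a model category. -/
def IsHomotopyEquivalence {X Y : C} (f : X ⟶ Y) : Prop :=
  ∃ g : Y ⟶ X, Homotopic (f ≫ g) (𝟙 X) ∧ Homotopic (g ≫ f) (𝟙 Y)

end Model

/-- The homotopy equivalences of the model structure `M` are exactly the homomorphic equivalences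
(the `f : X ⟶ Y` for which there is also some `Y ⟶ X`). Moreover they are the weak equivalences,
all objects are fibrant and cofibrant, and the acyclic fibrations are the retractions (the last
two properties and the weak equivalences determine the model structure). -/
structure IsHomomorphicModelStructure {C : Type*} [Category C] (M : ModelCategory C) : Prop where
  homotopyEquivalence_iff {X Y : C} (f : X ⟶ Y) : IsHomotopyEquivalence f ↔ Nonempty (Y ⟶ X)
  weakEquivalence_iff {X Y : C} (f : X ⟶ Y) : WeakEquivalence f ↔ Nonempty (Y ⟶ X)
  isCofibrant (X : C) : IsCofibrant X
  isFibrant (X : C) : IsFibrant X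
  acyclicFibration_iff {X Y : C} (f : X ⟶ Y) :
    (Fibration f ∧ WeakEquivalence f) ↔ IsSplitEpi f

end FMT

/-! ### The model structure whose weak equivalences are the maps with a map backwards -/

namespace FMT

namespace HomModel

open Limits

variable {C : Type*} [Category C]

/-! The model structure is formal and exists on every category with finite limits and colimits.
Since `coprod.inl` followed by `coprod.desc f (𝟙 Y)` factors any `f`, the split epimorphisms and
their left lifting class form a weak factorization system. Call a map a weak equivalence when some
map goes back. The fibrations then become the `p : E ⟶ D` through which every `Z ⟶ D` lifts as soon
as `Z` maps to `E` at all (`rlp_iff_exists_lift`), and `X ⟶ X ⨿ (X ⨯ Y) ⟶ Y` gives the second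
factorization. Now `X ⨿ X` is a cylinder and `Y ⨯ Y` a path object, so all parallel maps are
homotopic, and a homotopy equivalence is just a map with some map back. For finite structures this
is `k`-homotopic equivalence for all `k`, because each structure can serve as its own test
structure.

It remains to find finite limits and colimits. For structures whose only function symbols are
constants they are built by hand. The `d`-neighbourhoods are exactly the structures all of whose
elements lie within distance `d` of a constant; these form a coreflective subcategory closed under
finite colimits.

The logical statement is a game argument. Extendability supplies the answers in an
Ehrenfeucht–Fraïssé game whose positions are tuples related by `KHomEquiv`, so `k`-homotopic
structures are logically equivalent (`realize_iff_of_kHomEquiv`). The converse needs no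
extendability: logical equivalence lets partial homomorphisms be extended `k` times
(`forth_of_realize`), and a test structure of tree-depth at most `k` is mapped by playing along the
branches of its forest (`exists_copy_of_forth`, `exists_hom_of_forth`). -/

/-- The split epimorphisms of a category. -/
def splitEpis (C : Type*) [Category C] : MorphismProperty C := fun _ _ f => IsSplitEpi f

/-- The morphisms `f : X ⟶ Y` for which there is some morphism `Y ⟶ X`. -/
def reversible (C : Type*) [Category C] : MorphismProperty C := fun X Y _ => Nonempty (Y ⟶ X)

theorem isSplitEpi_of_section {X Y : C} {f : X ⟶ Y} (s : Y ⟶ X) (h : s ≫ f = 𝟙 Y) :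
    IsSplitEpi f :=
  ⟨⟨⟨s, h⟩⟩⟩

/-- On the summand `Z` nothing is prescribed by the top of the square, so a section of `p` lifts it.
-/
theorem llp_coprod_inl [HasBinaryCoproducts C] (X Z : C) :
    (splitEpis C).llp (coprod.inl : X ⟶ X ⨿ Z) := by
  intro E D p hp
  have : IsSplitEpi p := hp
  refine ⟨fun {u v} sq =>
    ⟨⟨⟨coprod.desc u (coprod.inr ≫ v ≫ section_ p), coprod.inl_desc _ _, ?_⟩⟩⟩⟩
  apply coprod.hom_ext
  · rw [← Category.assoc, coprod.inl_desc, sq.w]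
  · rw [← Category.assoc, coprod.inr_desc]
    simp

/-- A cofibration `i : A ⟶ B` is a retract of the inclusion `A ⟶ A ⨿ B`. -/
theorem exists_section_of_llp [HasBinaryCoproducts C] {A B : C} {i : A ⟶ B}
    (hi : (splitEpis C).llp i) :
    ∃ s : B ⟶ A ⨿ B, i ≫ s = coprod.inl ∧ s ≫ coprod.desc i (𝟙 B) = 𝟙 B := by
  have := hi (coprod.desc i (𝟙 B)) (isSplitEpi_of_section coprod.inr (coprod.inr_desc _ _))
  have sq : CommSq (coprod.inl : A ⟶ A ⨿ B) i (coprod.desc i (𝟙 B)) (𝟙 B) :=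
    ⟨by rw [coprod.inl_desc, Category.comp_id]⟩
  exact ⟨sq.lift, sq.fac_left, sq.fac_right⟩

/-- The right lifting property against reversible cofibrations, made explicit. -/
theorem rlp_iff_exists_lift [HasBinaryCoproducts C] {E D : C} (p : E ⟶ D) :
    ((splitEpis C).llp ⊓ reversible C).rlp p ↔
      ∀ (Z : C) (_ : Z ⟶ E) (z : Z ⟶ D), ∃ w : Z ⟶ E, w ≫ p = z := by
  constructor
  -- The map `a` makes `E ⟶ E ⨿ Z` reversible, so `p` lifts against it.
  · intro hp Z a z
    have := hp (coprod.inl : E ⟶ E ⨿ Z) ⟨llp_coprod_inl E Z, ⟨coprod.desc (𝟙 E) a⟩⟩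
    have sq : CommSq (𝟙 E) (coprod.inl : E ⟶ E ⨿ Z) p (coprod.desc p z) :=
      ⟨by rw [coprod.inl_desc, Category.id_comp]⟩
    refine ⟨coprod.inr ≫ sq.lift, ?_⟩
    rw [Category.assoc, sq.fac_right, coprod.inr_desc]
  · rintro hp A B i ⟨hi, ⟨r⟩⟩
    obtain ⟨s, hs, hs'⟩ := exists_section_of_llp hi
    refine ⟨fun {u v} sq => ?_⟩
    -- `w` lifts `v` but need not restrict to `u` along `i`; routing `B` through `A ⨿ B` by `s`
    -- corrects this.
    obtain ⟨w, hw⟩ := hp B (r ≫ u) v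
    refine ⟨⟨⟨s ≫ coprod.desc u w, ?_, ?_⟩⟩⟩
    · rw [← Category.assoc, hs, coprod.inl_desc]
    · have : coprod.desc u w ≫ p = coprod.desc i (𝟙 B) ≫ v := by
        apply coprod.hom_ext
        · rw [← Category.assoc, ← Category.assoc, coprod.inl_desc, coprod.inl_desc, sq.w]
        · rw [← Category.assoc, ← Category.assoc, coprod.inr_desc, coprod.inr_desc, hw,
            Category.id_comp]
      rw [Category.assoc, this, ← Category.assoc, hs', Category.id_comp]

/-- A map back `D ⟶ E` permits lifting `𝟙 D` through a fibration, and the lift is a section. -/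
theorem rlp_inf_reversible [HasBinaryCoproducts C] :
    ((splitEpis C).llp ⊓ reversible C).rlp ⊓ reversible C = splitEpis C := by
  ext E D p
  constructor
  · rintro ⟨hp, ⟨r⟩⟩
    obtain ⟨w, hw⟩ := (rlp_iff_exists_lift p).1 hp D r (𝟙 D)
    exact isSplitEpi_of_section w hw
  · intro h
    have : IsSplitEpi p := h
    exact ⟨(rlp_iff_exists_lift p).2 fun Z _ z => ⟨z ≫ section_ p, by simp⟩, ⟨section_ p⟩⟩

instance [HasBinaryCoproducts C] :
    MorphismProperty.IsWeakFactorizationSystem (splitEpis C).llp (splitEpis C) where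
  llp := rfl
  rlp := by
    refine le_antisymm (fun E D p hp => ?_) (fun E D p hp A B i hi => hi p hp)
    have := hp (coprod.inl : E ⟶ E ⨿ D) (llp_coprod_inl E D)
    have sq : CommSq (𝟙 E) (coprod.inl : E ⟶ E ⨿ D) p (coprod.desc p (𝟙 D)) :=
      ⟨by rw [coprod.inl_desc, Category.id_comp]⟩
    refine isSplitEpi_of_section (coprod.inr ≫ sq.lift) ?_
    rw [Category.assoc, sq.fac_right, coprod.inr_desc]
  hasFactorization := ⟨fun {X Y} f => ⟨
    { Z := X ⨿ Y
      i := coprod.inl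
      p := coprod.desc f (𝟙 Y)
      fac := coprod.inl_desc _ _
      hi := llp_coprod_inl X Y
      hp := isSplitEpi_of_section coprod.inr (coprod.inr_desc _ _) }⟩⟩

/-- Every morphism `f : X ⟶ Y` factors through `X ⨿ (X ⨯ Y)` as a reversible cofibration followed
by a fibration. -/
theorem hasFactorization_llp_inf_reversible [HasBinaryCoproducts C] [HasBinaryProducts C] :
    MorphismProperty.HasFactorization ((splitEpis C).llp ⊓ reversible C)
      ((splitEpis C).llp ⊓ reversible C).rlp :=
  ⟨fun {X Y} f => ⟨
    { Z := X ⨿ (X ⨯ Y)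
      i := coprod.inl
      p := coprod.desc f prod.snd
      fac := coprod.inl_desc _ _
      hi := ⟨llp_coprod_inl _ _, ⟨coprod.desc (𝟙 X) prod.fst⟩⟩
      hp := (rlp_iff_exists_lift _).2 fun Z a z =>
        ⟨prod.lift (a ≫ coprod.desc (𝟙 X) prod.fst) z ≫ coprod.inr, by
          rw [Category.assoc, coprod.inr_desc, prod.lift_snd]⟩ }⟩⟩

instance [HasBinaryCoproducts C] [HasBinaryProducts C] :
    MorphismProperty.IsWeakFactorizationSystem ((splitEpis C).llp ⊓ reversible C)
      ((splitEpis C).llp ⊓ reversible C).rlp where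
  rlp := rfl
  llp := by
    refine le_antisymm (fun A B i hi => ⟨fun E D p hp => hi p ?_, ?_⟩)
      (fun A B i hi E D p hp => hp i hi)
    · rw [← rlp_inf_reversible] at hp
      exact hp.1
    -- Retract argument: lifting against the fibration part sends `B` to the middle object, which
    -- maps back to `A`.
    · have h := hasFactorization_llp_inf_reversible (C := C)
      obtain ⟨Z, j, p, fac, ⟨_, ⟨r⟩⟩, hp⟩ := (h.nonempty_mapFactorizationData i).some
      have := hi p hp
      have sq : CommSq j i p (𝟙 B) := ⟨by rw [fac, Category.comp_id]⟩
      exact ⟨sq.lift ≫ r⟩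
  hasFactorization := hasFactorization_llp_inf_reversible

instance : (reversible C).HasTwoOutOfThreeProperty where
  comp_mem _ _ := fun ⟨r⟩ ⟨s⟩ => ⟨s ≫ r⟩
  of_postcomp _ g := fun _ ⟨t⟩ => ⟨g ≫ t⟩
  of_precomp f _ := fun _ ⟨t⟩ => ⟨t ≫ f⟩

/-- The model structure in which the acyclic fibrations are the split epimorphisms and the weak
equivalences are the morphisms `X ⟶ Y` for which there is some morphism `Y ⟶ X`. -/
@[reducible] noncomputable def modelCategory (C : Type*) [Category C]
    [HasFiniteLimits C] [HasFiniteColimits C] : ModelCategory C :=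
  letI : CategoryWithWeakEquivalences C := ⟨reversible C⟩
  letI : CategoryWithCofibrations C := ⟨(splitEpis C).llp⟩
  letI : CategoryWithFibrations C := ⟨((splitEpis C).llp ⊓ reversible C).rlp⟩
  haveI : (weakEquivalences C).HasTwoOutOfThreeProperty :=
    inferInstanceAs (reversible C).HasTwoOutOfThreeProperty
  haveI : MorphismProperty.IsWeakFactorizationSystem (cofibrations C) (trivialFibrations C) := by
    rw [show trivialFibrations C = splitEpis C from rlp_inf_reversible]
    exact inferInstanceAs (MorphismProperty.IsWeakFactorizationSystem (splitEpis C).llp _)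
  haveI : MorphismProperty.IsWeakFactorizationSystem (trivialCofibrations C) (fibrations C) :=
    inferInstanceAs (MorphismProperty.IsWeakFactorizationSystem
      ((splitEpis C).llp ⊓ reversible C) ((splitEpis C).llp ⊓ reversible C).rlp)
  ModelCategory.mk' C

variable [HasFiniteLimits C] [HasFiniteColimits C]

theorem weakEquivalence_iff {X Y : C} (f : X ⟶ Y) :
    letI := modelCategory C
    WeakEquivalence f ↔ Nonempty (Y ⟶ X) :=
  letI := modelCategory C
  HomotopicalAlgebra.weakEquivalence_iff f

/-- Folding `X ⨿ X ⟶ X` and the diagonal `Y ⟶ Y ⨯ Y` are weak equivalences, having maps back; the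
universal properties then supply both homotopies. -/
theorem homotopic {X Y : C} (f g : X ⟶ Y) :
    letI := modelCategory C
    Homotopic f g := by
  let := modelCategory C
  constructor
  · refine ⟨{ I := X ⨿ X, i₀ := coprod.inl, i₁ := coprod.inr, π := coprod.desc (𝟙 X) (𝟙 X),
              i₀_π := coprod.inl_desc _ _, i₁_π := coprod.inr_desc _ _,
              weakEquivalence_π := (weakEquivalence_iff _).2 ⟨coprod.inl⟩ },
      ⟨⟨coprod.desc f g, coprod.inl_desc _ _, coprod.inr_desc _ _⟩⟩⟩
  · refine ⟨{ P := Y ⨯ Y, p₀ := prod.fst, p₁ := prod.snd, ι := prod.lift (𝟙 Y) (𝟙 Y),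
              ι_p₀ := prod.lift_fst _ _, ι_p₁ := prod.lift_snd _ _,
              weakEquivalence_ι := (weakEquivalence_iff _).2 ⟨prod.fst⟩ },
      ⟨⟨prod.lift f g, prod.lift_fst _ _, prod.lift_snd _ _⟩⟩⟩

theorem isHomotopyEquivalence_iff {X Y : C} (f : X ⟶ Y) :
    letI := modelCategory C
    IsHomotopyEquivalence f ↔ Nonempty (Y ⟶ X) :=
  ⟨fun ⟨g, _⟩ => ⟨g⟩, fun ⟨g⟩ => ⟨g, homotopic _ _, homotopic _ _⟩⟩

theorem isHomomorphicModelStructure (C : Type*) [Category C]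
    [HasFiniteLimits C] [HasFiniteColimits C] :
    IsHomomorphicModelStructure (modelCategory C) :=
  letI := modelCategory C
  { homotopyEquivalence_iff := isHomotopyEquivalence_iff
    weakEquivalence_iff := weakEquivalence_iff
    isCofibrant := fun X => by
      refine (cofibration_iff _).2 fun E D p hp => ?_
      have : IsSplitEpi p := hp
      exact ⟨fun {u v} sq => ⟨⟨⟨v ≫ section_ p, initialIsInitial.hom_ext _ _, by simp⟩⟩⟩⟩
    isFibrant := fun X =>
      (fibration_iff _).2 ((rlp_iff_exists_lift _).2 fun _ a _ =>
        ⟨a, terminalIsTerminal.hom_ext _ _⟩)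
    acyclicFibration_iff := fun f => by
      rw [← mem_trivialFibrations_iff]
      exact iff_of_eq (congrArg (fun W : MorphismProperty C => W f) rlp_inf_reversible) }

end HomModel

end FMT

/-! ### Finite limits and colimits of finite structures -/

namespace FMT

namespace FinStruct

open Limits FirstOrder.Language

variable {L : FirstOrder.Language.{0, 0}}

/-- A morphism of finite structures as a homomorphism. -/
abbrev toHom {A B : FinStruct L} (f : A ⟶ B) : A →[L] B := f

theorem hom_ext {A B : FinStruct L} {f g : A ⟶ B} (h : ∀ x, toHom f x = toHom g x) : f = g :=
  Language.Hom.ext h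

theorem toHom_comp {A B D : FinStruct L} (f : A ⟶ B) (g : B ⟶ D) (x : A) :
    toHom (f ≫ g) x = toHom g (toHom f x) :=
  rfl

/-! ### Finite limits, computed componentwise -/

section Limit

variable {J : Type} [SmallCategory J] (F : J ⥤ FinStruct L)

/-- The compatible families of elements of a diagram of structures. -/
def Sections : Type :=
  {x : ∀ j, F.obj j // ∀ {i j : J} (u : i ⟶ j), toHom (F.map u) (x i) = x j}

instance : L.Structure (Sections F) where
  funMap f c := ⟨fun j => Structure.funMap f fun i => (c i).1 j, fun u => by
    rw [Language.Hom.map_fun]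
    exact congrArg _ (funext fun i => (c i).2 u)⟩
  RelMap R c := ∀ j, Structure.RelMap R fun i => (c i).1 j

variable [FinCategory J]

instance : Finite (Sections F) :=
  inferInstanceAs (Finite {_x : ∀ j, F.obj j // _})

/-- The limit cone on the compatible families. -/
def limitCone : Cone F where
  pt := ⟨Sections F⟩
  π :=
    { app := fun j =>
        { toFun := fun x => x.1 j
          map_fun' := fun _ _ => rfl
          map_rel' := fun _ _ h => h j }
      naturality := fun _ _ u => hom_ext fun x => (x.2 u).symm }

/-- The compatible families form a limit. -/
def limitConeIsLimit : IsLimit (limitCone F) where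
  lift s :=
    { toFun := fun x => ⟨fun j => toHom (s.π.app j) x, fun u => by
        rw [← toHom_comp, s.w]⟩
      map_fun' := fun f c => Subtype.ext (funext fun j => Language.Hom.map_fun (toHom (s.π.app j)) f c)
      map_rel' := fun R c h j => Language.Hom.map_rel (toHom (s.π.app j)) R c h }
  fac _ _ := rfl
  uniq s m h := hom_ext fun x => Subtype.ext (funext fun j =>
    congrArg (fun f => toHom f x) (h j))

end Limit

instance : HasFiniteLimits (FinStruct L) :=
  ⟨fun _ _ _ => ⟨fun F => ⟨⟨⟨limitCone F, limitConeIsLimit F⟩⟩⟩⟩⟩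

/-! ### Finite colimits of structures with only constants as functions -/

section Colimit

variable {J : Type} [SmallCategory J] (F : J ⥤ FinStruct L)

/-- The identifications made in the colimit of a diagram of structures in which all function
symbols are constants. -/
inductive ColimitRel : (Σ j, F.obj j) ⊕ L.Constants → (Σ j, F.obj j) ⊕ L.Constants → Prop
  | map {i j : J} (u : i ⟶ j) (x : F.obj i) :
      ColimitRel (.inl ⟨i, x⟩) (.inl ⟨j, toHom (F.map u) x⟩)
  -- The free-standing copy of each constant glues its interpretations together and interprets it
  -- even when the diagram is empty.
  | const (j : J) (s : L.Constants) : ColimitRel (.inl ⟨j, (s : F.obj j)⟩) (.inr s)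

/-- The universe of the colimit. -/
def ColimitCarrier : Type := Quot (ColimitRel F)

/-- The map of the `j`-th structure of a diagram to the colimit. -/
def colimitMk (j : J) (x : F.obj j) : ColimitCarrier F := Quot.mk _ (.inl ⟨j, x⟩)

variable [∀ n, IsEmpty (L.Functions (n + 1))]

instance : L.Structure (ColimitCarrier F) where
  funMap {n} f _ :=
    match n, f with
    | 0, f => Quot.mk _ (.inr f)
    | _ + 1, f => isEmptyElim f
  RelMap R c := ∃ (j : J) (x : _ → F.obj j), Structure.RelMap R x ∧ c = fun i => colimitMk F j (x i)

theorem colimitMk_const (j : J) (s : L.Constants) :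
    colimitMk F j (s : F.obj j) = (s : ColimitCarrier F) :=
  Quot.sound (.const j s)

variable [Finite L.Constants] [FinCategory J]

instance : Finite (ColimitCarrier F) :=
  inferInstanceAs (Finite (Quot (ColimitRel F)))

/-- The colimit cocone. -/
def colimitCocone : Cocone F where
  pt := ⟨ColimitCarrier F⟩
  ι :=
    { app := fun j =>
        { toFun := colimitMk F j
          map_fun' := fun {n} f c =>
            match n, f, c with
            | 0, f, c => by
              rw [funMap_eq_coe_constants, colimitMk_const]
              rfl
            | n + 1, f, _ => isEmptyElim f
          map_rel' := fun _ c h => ⟨j, c, h, rfl⟩ }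
      naturality := fun i j u => hom_ext fun x => (Quot.sound (.map u x)).symm }

/-- The underlying map of the homomorphism from the colimit induced by a cocone. -/
def colimitDesc (s : Cocone F) : ColimitCarrier F → s.pt :=
  Quot.lift (Sum.elim (fun x => toHom (s.ι.app x.1) x.2) fun t => (t : s.pt)) (by
    rintro _ _ (⟨u, x⟩ | ⟨j, t⟩)
    · simp only [Sum.elim_inl]
      rw [← toHom_comp, s.w]
    · exact Language.Hom.map_constants (toHom (s.ι.app j)) t)

/-- The colimit cocone is a colimit. -/
def colimitCoconeIsColimit : IsColimit (colimitCocone F) where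
  desc s :=
    { toFun := colimitDesc F s
      map_fun' := fun {n} f c =>
        match n, f, c with
        | 0, f, c => by
          rw [funMap_eq_coe_constants]
          exact funMap_eq_coe_constants.symm
        | n + 1, f, _ => isEmptyElim f
      map_rel' := by
        rintro n R _ ⟨j, x, h, rfl⟩
        exact Language.Hom.map_rel (toHom (s.ι.app j)) R x h }
  fac _ _ := rfl
  uniq s m h := hom_ext fun x => by
    induction x using Quot.ind with
    | mk x =>
      rcases x with ⟨j, x⟩ | t
      · exact congrArg (fun f => toHom f x) (h j)
      · exact Language.Hom.map_constants (toHom m) t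

end Colimit

instance [∀ n, IsEmpty (L.Functions (n + 1))] [Finite L.Constants] :
    HasFiniteColimits (FinStruct L) :=
  ⟨fun _ _ _ => ⟨fun F => ⟨⟨⟨colimitCocone F, colimitCoconeIsColimit F⟩⟩⟩⟩⟩

/-- Every element of a finite colimit is a constant or comes from the diagram. -/
theorem colimitCocone_cases [∀ n, IsEmpty (L.Functions (n + 1))] [Finite L.Constants]
    {J : Type} [SmallCategory J] [FinCategory J] (F : J ⥤ FinStruct L)
    (x : (colimitCocone F).pt) :
    (∃ s : L.Constants, (s : (colimitCocone F).pt) = x) ∨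
      ∃ (j : J) (y : F.obj j), toHom ((colimitCocone F).ι.app j) y = x := by
  induction x using Quot.ind with
  | mk x =>
    rcases x with ⟨j, y⟩ | s
    · exact .inr ⟨j, y, rfl⟩
    · exact .inl ⟨s, rfl⟩

end FinStruct

end FMT

/-! ### The category of neighbourhoods -/

namespace FMT

open Limits FirstOrder.Language

/-- The limit is the coreflection of the ambient limit. -/
theorem hasLimitsOfShape_of_coreflections {C : Type*} [Category C] (P : ObjectProperty C)
    (J : Type*) [Category J] [HasLimitsOfShape J C]
    (h : ∀ X : C, ∃ (R : C) (_ : P R) (r : R ⟶ X),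
      ∀ Y : C, P Y → ∀ f : Y ⟶ X, ∃! g : Y ⟶ R, g ≫ r = f) :
    HasLimitsOfShape J P.FullSubcategory := by
  refine ⟨fun F => ?_⟩
  obtain ⟨R, hR, r, hr⟩ := h (limit (F ⋙ P.ι))
  let c : Cone F :=
    { pt := ⟨R, hR⟩
      π :=
        { app := fun j => P.homMk (r ≫ limit.π (F ⋙ P.ι) j)
          naturality := fun i j u => by
            ext
            have := limit.w (F ⋙ P.ι) u
            change 𝟙 R ≫ r ≫ limit.π (F ⋙ P.ι) j =
              (r ≫ limit.π (F ⋙ P.ι) i) ≫ (F ⋙ P.ι).map u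
            rw [Category.id_comp, Category.assoc, this] } }
  choose g hg hg' using fun s : Cone F =>
    hr s.pt.obj s.pt.property (limit.lift (F ⋙ P.ι) (P.ι.mapCone s))
  refine ⟨⟨⟨c, ⟨fun s => P.homMk (g s), fun s j => ?_, fun s m hm => ?_⟩⟩⟩⟩
  · ext
    change g s ≫ r ≫ limit.π (F ⋙ P.ι) j = (s.π.app j).hom
    rw [← Category.assoc, hg, limit.lift_π]
    rfl
  · ext
    refine hg' s m.hom ?_
    refine limit.hom_ext fun j => ?_
    rw [limit.lift_π, Category.assoc]
    exact congrArg (fun f => f.hom) (hm j)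

/-! ### Structures within bounded distance of the constants -/

section Near

variable {L : FirstOrder.Language.{0, 0}}

/-- The elements at Gaifman distance at most `d` from some constant. -/
def IsNear {A : Type} [L.Structure A] : ℕ → A → Prop
  | 0, x => ∃ s : L.Constants, (s : A) = x
  | d + 1, x => IsNear d x ∨ ∃ (p : ℕ) (R : L.Relations p) (c : Fin p → A) (i j : Fin p),
      Structure.RelMap R c ∧ IsNear d (c i) ∧ c j = x

variable {A B : Type} [L.Structure A] [L.Structure B]

theorem IsNear.mono {d e : ℕ} (h : d ≤ e) {x : A} (hx : IsNear (L := L) d x) :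
    IsNear (L := L) e x := by
  induction h with
  | refl => exact hx
  | step _ ih => exact .inl ih

theorem IsNear.map (f : A →[L] B) : ∀ {d : ℕ} {x : A}, IsNear (L := L) d x →
    IsNear (L := L) d (f x)
  | 0, _, ⟨s, hs⟩ => ⟨s, by rw [← hs, f.map_constants]⟩
  | _ + 1, _, .inl h => .inl (IsNear.map f h)
  | _ + 1, _, .inr ⟨p, R, c, i, j, hR, hi, hj⟩ =>
    .inr ⟨p, R, f ∘ c, i, j, f.map_rel R c hR, IsNear.map f hi, congrArg f hj⟩

variable [∀ n, IsEmpty (L.Functions (n + 1))]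

variable (L A) in
/-- The substructure of the elements at Gaifman distance at most `d` from some constant. -/
def nearPart (d : ℕ) : L.Substructure A where
  carrier := {x | IsNear (L := L) d x}
  fun_mem {n} f c _ :=
    match n, f, c with
    | 0, f, _ => IsNear.mono (Nat.zero_le d) ⟨f, funMap_eq_coe_constants.symm⟩
    | _ + 1, f, _ => isEmptyElim f

/-- Every entry of a tuple used in a step up to distance `d` is itself within distance `d`, so the
witnessing chain stays inside the substructure. -/
theorem isNear_nearPart {d : ℕ} : ∀ {e : ℕ}, e ≤ d → ∀ x : nearPart L A d,
    IsNear (L := L) e (x : A) → IsNear (L := L) e x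
  | 0, _, _, ⟨s, hs⟩ => ⟨s, Subtype.ext (hs ▸ funMap_eq_coe_constants)⟩
  | _ + 1, he, x, .inl h => .inl (isNear_nearPart (Nat.le_of_succ_le he) x h)
  | _ + 1, he, _, .inr ⟨p, R, c, i, j, hR, hi, hj⟩ =>
    .inr ⟨p, R, fun l => ⟨c l, IsNear.mono he (.inr ⟨p, R, c, i, l, hR, hi, rfl⟩)⟩, i, j, hR,
      isNear_nearPart (Nat.le_of_succ_le he) _ hi, Subtype.ext hj⟩

variable (L) in
/-- The structures in which every element has Gaifman distance at most `d` from some constant. -/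
def nearStructures (d : ℕ) : ObjectProperty (FinStruct L) :=
  fun A => ∀ x : A, IsNear (L := L) d x

/-- Homomorphisms do not increase the distance from the constants, so maps from near structures land
in `nearPart`. -/
theorem exists_coreflection_nearStructures (d : ℕ) (X : FinStruct L) :
    ∃ (R : FinStruct L) (_ : nearStructures L d R) (r : R ⟶ X),
      ∀ (Y : FinStruct L), nearStructures L d Y → ∀ f : Y ⟶ X, ∃! g : Y ⟶ R, g ≫ r = f :=
  ⟨⟨nearPart L X d⟩, fun x => isNear_nearPart le_rfl x x.2, (nearPart L X d).subtype.toHom,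
    fun _ hY f => ⟨Language.Hom.codRestrict (nearPart L X d) f fun y => (hY y).map f,
      rfl, fun _ hg => FinStruct.hom_ext fun y => Subtype.ext
        (congrArg (fun h => FinStruct.toHom h y) hg)⟩⟩

instance (d : ℕ) : HasFiniteLimits (nearStructures L d).FullSubcategory :=
  ⟨fun J _ _ => hasLimitsOfShape_of_coreflections _ J (exists_coreflection_nearStructures d)⟩

instance (d : ℕ) [Finite L.Constants] : HasFiniteColimits (nearStructures L d).FullSubcategory :=
  ⟨fun J _ _ => ⟨fun F => by
    have := createsColimitFullSubcategoryInclusion' F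
      (FinStruct.colimitCoconeIsColimit (F ⋙ (nearStructures L d).ι)) fun x => by
        rcases FinStruct.colimitCocone_cases _ x with ⟨s, hs⟩ | ⟨j, y, rfl⟩
        · exact IsNear.mono (Nat.zero_le d) ⟨s, hs⟩
        · exact ((F.obj j).property y).map _
    exact hasColimit_of_created F (nearStructures L d).ι⟩⟩

end Near

/-! ### Neighbourhoods as near structures -/

section Neighborhoods

variable {σ : FirstOrder.Language.{0, 0}} {n : ℕ}

theorem edist_le_succ_cases {V : Type} {G : SimpleGraph V} {u v : V} {e : ℕ}
    (h : G.edist u v ≤ (e + 1 : ℕ)) :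
    G.edist u v ≤ e ∨ ∃ w, G.edist u w ≤ e ∧ G.Adj w v := by
  obtain ⟨p, hp⟩ := SimpleGraph.exists_walk_of_edist_ne_top
    (ne_top_of_le_ne_top (ENat.natCast_ne_top _) h)
  rw [← hp, Nat.cast_le] at h
  rw [← SimpleGraph.Walk.length_reverse] at h
  cases hq : p.reverse with
  | nil => exact .inl (by simp)
  | cons hadj q =>
    rw [hq, SimpleGraph.Walk.length_cons] at h
    refine .inr ⟨_, (SimpleGraph.edist_le q.reverse).trans ?_, hadj.symm⟩
    rw [SimpleGraph.Walk.length_reverse, Nat.cast_le]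
    omega

theorem edist_le_succ_of_relMap {A : Type} [σ.Structure A] {u : A} {e p : ℕ} {R : σ.Relations p}
    {c : Fin p → A} (hR : Structure.RelMap R c) {i : Fin p}
    (h : (gaifmanGraph (L := σ) A).edist u (c i) ≤ e) (j : Fin p) :
    (gaifmanGraph (L := σ) A).edist u (c j) ≤ (e + 1 : ℕ) := by
  refine (SimpleGraph.edist_triangle (v := c i)).trans ?_
  rw [Nat.cast_add, Nat.cast_one]
  refine add_le_add h (SimpleGraph.edist_le_one_iff_adj_or_eq.2 ?_)
  by_cases hij : c i = c j
  · exact .inr hij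
  · exact .inl ⟨hij, p, R, c, hR, ⟨i, rfl⟩, ⟨j, rfl⟩⟩

variable [σ.IsRelational]

instance (m : ℕ) : IsEmpty ((σ.withConstants (Fin n)).Functions (m + 1)) :=
  inferInstanceAs (IsEmpty (σ.Functions (m + 1) ⊕ PEmpty))

instance : Finite (σ.withConstants (Fin n)).Constants :=
  inferInstanceAs (Finite (σ.Functions 0 ⊕ Fin n))

theorem isNear_neighborhood_of_edist_le (A : FinStruct σ) (d : ℕ) (a : Fin n → A) (i : Fin n) :
    ∀ e : ℕ, e ≤ d → ∀ b : ball A d a, (gaifmanGraph (L := σ) A).edist (a i) b ≤ e →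
      IsNear (A := neighborhood A d a) (L := σ.withConstants (Fin n)) e b
  | 0, _, b, h => by
    have : a i = b := by simpa using h
    exact ⟨σ.con i, Subtype.ext this⟩
  | e + 1, he, b, h => by
    rcases edist_le_succ_cases h with h | ⟨w, hw, -, p, R, c, hR, ⟨j, rfl⟩, ⟨l, hl⟩⟩
    · exact .inl (isNear_neighborhood_of_edist_le A d a i e (Nat.le_of_succ_le he) b h)
    -- The whole related tuple, not only the edge it induces, must lie in the ball to remain a tuple
    -- of the neighbourhood.
    · have hc : ∀ l, c l ∈ ball A d a := fun l =>
        ⟨i, (edist_le_succ_of_relMap hR hw l).trans (by exact_mod_cast he)⟩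
      exact .inr ⟨p, Sum.inl R, fun l => ⟨c l, hc l⟩, j, l, hR,
        isNear_neighborhood_of_edist_le A d a i e (Nat.le_of_succ_le he) ⟨c j, hc j⟩ hw,
        Subtype.ext hl⟩

theorem isNear_neighborhood (A : FinStruct σ) (d : ℕ) (a : Fin n → A) :
    nearStructures (σ.withConstants (Fin n)) d (neighborhood A d a) := by
  rintro ⟨b, i, hi⟩
  exact isNear_neighborhood_of_edist_le A d a i d le_rfl ⟨b, i, hi⟩ hi

/-- The structure obtained by forgetting the constants. -/
def reduct (N : FinStruct (σ.withConstants (Fin n))) : FinStruct σ :=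
  letI : σ.Structure N :=
    { funMap := fun f c => Structure.funMap (L := σ.withConstants (Fin n)) (Sum.inl f) c
      RelMap := fun R c => Structure.RelMap (L := σ.withConstants (Fin n)) (Sum.inl R) c }
  ⟨N⟩

/-- The tuple of the interpretations of the constants. -/
def reductConstants (N : FinStruct (σ.withConstants (Fin n))) (i : Fin n) : reduct N :=
  ((σ.con i : (σ.withConstants (Fin n)).Constants) : N)

theorem mem_ball_reduct (N : FinStruct (σ.withConstants (Fin n))) :
    ∀ {e : ℕ} {x : N}, IsNear (L := σ.withConstants (Fin n)) e x →
      x ∈ ball (reduct N) e (reductConstants N)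
  | 0, x, ⟨.inr i, hs⟩ => by
    subst hs
    exact mem_ball (reduct N) 0 (reductConstants N) i
  | 0, _, ⟨.inl f, _⟩ => isEmptyElim f
  | e + 1, x, .inl h => by
    obtain ⟨i, hi⟩ := mem_ball_reduct N h
    exact ⟨i, hi.trans (by exact_mod_cast e.le_succ)⟩
  | e + 1, x, .inr ⟨p, .inl R, c, i, j, hR, hi, hj⟩ => by
    obtain ⟨l, hl⟩ := mem_ball_reduct N hi
    subst hj
    exact ⟨l, edist_le_succ_of_relMap (σ := σ) (A := reduct N) (R := R) (c := c) hR hl j⟩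

/-- A near structure is the whole `d`-ball around its constants in its own reduct. -/
theorem neighborhoods_of_isNear (d : ℕ) (N : FinStruct (σ.withConstants (Fin n)))
    (h : nearStructures _ d N) : neighborhoods σ n d N := by
  refine ⟨reduct N, reductConstants N, ⟨⟨⟨fun x => ⟨x, mem_ball_reduct N (h x)⟩, ?_, ?_⟩,
    ⟨fun x => x.1, ?_, ?_⟩, rfl, rfl⟩⟩⟩
  · rintro (_ | m) (f | f) c
    · exact isEmptyElim f
    · exact Subtype.ext (funMap_eq_coe_constants (L := σ.withConstants (Fin n)) (M := N))
    · exact isEmptyElim f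
    · exact isEmptyElim f
  · rintro m (R | R) c hR
    · exact hR
    · exact R.elim
  · rintro (_ | m) (f | f) c
    · exact isEmptyElim f
    · exact (funMap_eq_coe_constants (L := σ.withConstants (Fin n)) (M := N)).symm
    · exact isEmptyElim f
    · exact isEmptyElim f
  · rintro m (R | R) c hR
    · exact hR
    · exact R.elim

theorem neighborhoods_eq (d : ℕ) :
    neighborhoods σ n d = nearStructures (σ.withConstants (Fin n)) d := by
  ext N
  refine ⟨?_, neighborhoods_of_isNear d N⟩
  rintro ⟨A, a, ⟨e⟩⟩ x
  have := (isNear_neighborhood A d a (FinStruct.toHom e.hom x)).map (FinStruct.toHom e.inv)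
  rwa [← FinStruct.toHom_comp, e.hom_inv_id] at this

end Neighborhoods

end FMT

/-! ### Extendable structures: homotopic equivalence implies logical equivalence -/

namespace FMT

open FirstOrder.Language

variable {L : FirstOrder.Language.{0, 0}}

theorem KHomEquiv.symm {k m : ℕ} {A B : FinStruct L} {x : Fin m → A}
    {y : Fin m → B} (hk : KHomEquiv k A x B y) : KHomEquiv k B y A x :=
  ⟨hk.2, hk.1⟩

variable [∀ n, IsEmpty (L.Functions (n + 1))]

/-- The substructure of the constants and the entries of a tuple. -/
def namedPart (A : FinStruct L) {m : ℕ} (x : Fin m → A) : L.Substructure A where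
  carrier := {a | (∃ s : L.Constants, (s : A) = a) ∨ a ∈ Set.range x}
  fun_mem {n} f c _ :=
    match n, f, c with
    | 0, f, _ => .inl ⟨f, funMap_eq_coe_constants.symm⟩
    | _ + 1, f, _ => isEmptyElim f

/-- The named part is a legitimate test structure for every `k`: it has no unnamed elements, hence
tree-depth 0. -/
theorem KHomTo.exists_hom {k m : ℕ} {A B : FinStruct L} {x : Fin m → A} {y : Fin m → B}
    (h : KHomTo k A x B y) :
    ∃ g : namedPart A x →[L] B, ∀ i, g ⟨x i, .inr ⟨i, rfl⟩⟩ = y i := by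
  refine h ⟨namedPart A x⟩ (fun i => ⟨x i, .inr ⟨i, rfl⟩⟩) ?_
    ⟨(namedPart A x).subtype.toHom, fun i => rfl⟩
  have : IsEmpty (unnamed (⟨namedPart A x⟩ : FinStruct L)
      fun i => (⟨x i, .inr ⟨i, rfl⟩⟩ : namedPart A x)) := by
    refine ⟨?_⟩
    rintro ⟨⟨a, ⟨s, rfl⟩ | ⟨i, rfl⟩⟩, h₁, h₂⟩
    · exact h₁ s (Subtype.ext (((namedPart A x).subtype.toHom).map_constants s))
    · exact h₂ ⟨i, rfl⟩
  exact ⟨{ le := fun u => isEmptyElim u, le_refl := fun u => isEmptyElim u,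
           le_trans := fun u => isEmptyElim u, le_antisymm := fun u => isEmptyElim u },
    fun u => isEmptyElim u, fun u => isEmptyElim u, fun u => isEmptyElim u⟩

theorem KHomTo.eq_of_eq {k m : ℕ} {A B : FinStruct L} {x : Fin m → A} {y : Fin m → B}
    (h : KHomTo k A x B y) {i j : Fin m} (hij : x i = x j) : y i = y j := by
  obtain ⟨g, hg⟩ := h.exists_hom
  rw [← hg, ← hg]
  exact congrArg g (Subtype.ext hij)

/-- Atomic formulas are preserved by `0`-homomorphisms. -/
theorem KHomTo.realize_atomic {k m n : ℕ} {A B : FinStruct L} {x : Fin m → A} {y : Fin m → B}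
    (h : KHomTo k A x B y) (v : Fin n → Fin m) {e : Empty → A} {e' : Empty → B} :
    (∀ t₁ t₂ : L.Term (Empty ⊕ Fin n),
      t₁.realize (Sum.elim e (x ∘ v)) = t₂.realize (Sum.elim e (x ∘ v)) →
      t₁.realize (Sum.elim e' (y ∘ v)) = t₂.realize (Sum.elim e' (y ∘ v))) ∧
    ∀ (p : ℕ) (R : L.Relations p) (t : Fin p → L.Term (Empty ⊕ Fin n)),
      Structure.RelMap R (fun i => (t i).realize (Sum.elim e (x ∘ v))) →
      Structure.RelMap R fun i => (t i).realize (Sum.elim e' (y ∘ v)) := by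
  obtain ⟨g, hg⟩ := h.exists_hom
  let w : Empty ⊕ Fin n → namedPart A x := Sum.elim Empty.elim fun i => ⟨x (v i), .inr ⟨_, rfl⟩⟩
  have hA : ∀ t : L.Term (Empty ⊕ Fin n),
      t.realize (Sum.elim e (x ∘ v)) = ((t.realize w : namedPart A x) : A) := fun t => by
    have : Sum.elim e (x ∘ v) = (namedPart A x).subtype.toHom ∘ w := by
      ext (i | i)
      · exact i.elim
      · rfl
    rw [this, HomClass.realize_term]
    rfl
  have hB : ∀ t : L.Term (Empty ⊕ Fin n),
      t.realize (Sum.elim e' (y ∘ v)) = g (t.realize w) := fun t => by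
    have : Sum.elim e' (y ∘ v) = g ∘ w := by
      ext (i | i)
      · exact i.elim
      · exact (hg _).symm
    rw [this, HomClass.realize_term]
  simp only [hA, hB]
  exact ⟨fun _ _ h => congrArg g (Subtype.ext h), fun p R t h => g.map_rel R _ h⟩

/-- The answer of an extendable structure to an element of a homotopically equivalent one. -/
theorem IsExtendable.exists_extension {P : ObjectProperty (FinStruct L)} {k m : ℕ}
    {A B : FinStruct L} (hA : IsExtendable P k A) (hB : P B) {x : Fin m → A} {y : Fin m → B}
    (hm : m < k) (hx : Function.Injective x) (hy : Function.Injective y)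
    (h : KHomEquiv (k - m) A x B y) (b : B) :
    ∃ (m' : ℕ) (x' : Fin m' → A) (y' : Fin m' → B) (w : Fin m → Fin m') (j : Fin m'),
      m' ≤ m + 1 ∧ Function.Injective x' ∧ Function.Injective y' ∧
      KHomEquiv (k - m') A x' B y' ∧ x' ∘ w = x ∧ y' ∘ w = y ∧ y' j = b := by
  -- Extendability speaks only of distinct entries, so a repeated `b` costs no round and the tuple
  -- is kept.
  by_cases hb : b ∈ Set.range y
  · obtain ⟨j, rfl⟩ := hb
    exact ⟨m, x, y, id, j, m.le_succ, hx, hy, h, rfl, rfl, rfl⟩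
  · obtain ⟨a, ha⟩ := hA m x hm hx B y hB hy h b
    refine ⟨m + 1, Fin.snoc x a, Fin.snoc y b, Fin.castSucc, Fin.last m, le_rfl,
      Fin.snoc_injective_iff.2 ⟨hx, ?_⟩, Fin.snoc_injective_iff.2 ⟨hy, hb⟩, ha, ?_, ?_, ?_⟩
    -- An answer already among the `x i` would force `b` to equal `y i`.
    · rintro ⟨i, hi⟩
      have := ha.1.eq_of_eq (i := Fin.castSucc i) (j := Fin.last m) (by simpa using hi)
      exact hb ⟨i, by simpa using this⟩
    · ext i; simp
    · ext i; simp
    · simp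

/-- The game, by induction on the formula. The tuples `x`, `y` list distinct chosen elements, while
`v` lets several variables denote the same one. The bound `m + quantifierRank φ ≤ k` leaves a round
for each remaining quantifier. -/
theorem realize_iff_of_kHomEquiv {P : ObjectProperty (FinStruct L)} {k : ℕ} {A B : FinStruct L}
    (hA : IsExtendable P k A) (hB : IsExtendable P k B) (hPA : P A) (hPB : P B)
    (e : Empty → A) (e' : Empty → B) {n : ℕ} (φ : L.BoundedFormula Empty n) :
    ∀ {m : ℕ} {x : Fin m → A} {y : Fin m → B}, m + quantifierRank φ ≤ k →
      Function.Injective x → Function.Injective y → KHomEquiv (k - m) A x B y →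
      ∀ v : Fin n → Fin m, φ.Realize e (x ∘ v) ↔ φ.Realize e' (y ∘ v) := by
  have snoc_comp : ∀ {D : Type} {m m' n : ℕ} (x' : Fin m' → D) (w : Fin m → Fin m')
      (v : Fin n → Fin m) (j : Fin m'), (Fin.snoc ((x' ∘ w) ∘ v) (x' j) : Fin (n + 1) → D) =
        x' ∘ (Fin.snoc (w ∘ v) j : Fin (n + 1) → Fin m') := by
    intro D m m' n x' w v j
    rw [Fin.comp_snoc]
    rfl
  induction φ with
  | falsum => exact fun _ _ _ _ _ => Iff.rfl
  | equal t₁ t₂ =>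
    exact fun _ _ _ h v => ⟨(h.1.realize_atomic v).1 t₁ t₂, (h.2.realize_atomic v).1 t₁ t₂⟩
  | rel R t =>
    exact fun _ _ _ h v => ⟨(h.1.realize_atomic v).2 _ R t, (h.2.realize_atomic v).2 _ R t⟩
  | imp φ ψ ihφ ihψ =>
    intro m x y hk hx hy h v
    rw [quantifierRank] at hk
    exact imp_congr (ihφ (by omega) hx hy h v) (ihψ (by omega) hx hy h v)
  | all φ ih =>
    intro m x y hk hx hy h v
    rw [quantifierRank] at hk
    constructor
    · intro hφ b
      obtain ⟨m', x', y', w, j, hm', hx', hy', h', rfl, rfl, rfl⟩ :=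
        hA.exists_extension hPB (by omega) hx hy h b
      rw [snoc_comp, ← ih (by omega) hx' hy' h', ← snoc_comp]
      exact hφ _
    · intro hφ a
      obtain ⟨m', y', x', w, j, hm', hy', hx', h', rfl, rfl, rfl⟩ :=
        hB.exists_extension hPA (by omega) hy hx h.symm a
      rw [snoc_comp, ih (by omega) hx' hy' h'.symm, ← snoc_comp]
      exact hφ _

theorem logicallyEquivalent_of_kHomotopic {P : ObjectProperty (FinStruct L)} {k : ℕ}
    {A B : FinStruct L} (hA : IsExtendable P k A) (hB : IsExtendable P k B) (hPA : P A)
    (hPB : P B) (h : KHomotopic k A B) : LogicallyEquivalent k A B := by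
  intro φ hφ
  have := realize_iff_of_kHomEquiv hA hB hPA hPB default default φ (m := 0)
    (x := Fin.elim0) (y := Fin.elim0) (by omega) (Function.injective_of_subsingleton _)
    (Function.injective_of_subsingleton _) h Fin.elim0
  rw [Subsingleton.elim ((Fin.elim0 : Fin 0 → A) ∘ Fin.elim0) default,
    Subsingleton.elim ((Fin.elim0 : Fin 0 → B) ∘ Fin.elim0) default] at this
  exact this

end FMT

/-! ### Logical equivalence implies homotopic equivalence -/

namespace FMT

open FirstOrder.Language

variable {L : FirstOrder.Language.{0, 0}}

/-- A set of pairs is (the graph of) a partial homomorphism. -/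
def IsPartialHom {A B : FinStruct L} (T : Set (A × B)) : Prop :=
  (∀ p ∈ T, ∀ q ∈ T, p.1 = q.1 → p.2 = q.2) ∧
  ∀ (n : ℕ) (R : L.Relations n) (c : Fin n → A × B), (∀ i, c i ∈ T) →
    Structure.RelMap R (fun i => (c i).1) → Structure.RelMap R fun i => (c i).2

/-- The partial homomorphisms that can be extended `r` times to a further element. -/
def Forth {A B : FinStruct L} : ℕ → Set (A × B) → Prop
  | 0, T => IsPartialHom T
  | r + 1, T => IsPartialHom T ∧ ∀ a : A, ∃ b : B, Forth r (insert (a, b) T)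

theorem Forth.isPartialHom {A B : FinStruct L} :
    ∀ {r : ℕ} {T : Set (A × B)}, Forth r T → IsPartialHom T
  | 0, _, h => h
  | _ + 1, _, h => h.1

/-- The pairs of interpretations of the constants. -/
def constantPairs (A B : FinStruct L) : Set (A × B) :=
  Set.range fun s : L.Constants => ((s : A), (s : B))

/-- As `B` is finite, finitely many separating formulas suffice, and conjunction does not raise the
rank. -/
theorem exists_conjunction {A B : FinStruct L} {m r : ℕ} {x : Fin m → A} {y : B → Fin m → B}
    (h : ∀ b, ∃ φ : L.BoundedFormula Empty m, quantifierRank φ ≤ r ∧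
      φ.Realize default x ∧ ¬ φ.Realize default (y b)) :
    ∃ φ : L.BoundedFormula Empty m, quantifierRank φ ≤ r ∧
      φ.Realize default x ∧ ∀ b, ¬ φ.Realize default (y b) := by
  classical
  have := Fintype.ofFinite B
  suffices ∀ S : Finset B, ∃ φ : L.BoundedFormula Empty m, quantifierRank φ ≤ r ∧
      φ.Realize default x ∧ ∀ b ∈ S, ¬ φ.Realize default (y b) by
    obtain ⟨φ, h₁, h₂, h₃⟩ := this Finset.univ
    exact ⟨φ, h₁, h₂, fun b => h₃ b (Finset.mem_univ b)⟩
  intro S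
  induction S using Finset.induction_on with
  | empty => exact ⟨⊤, by simp [quantifierRank], by simp⟩
  | insert b S _ ih =>
    obtain ⟨φ, h₁, h₂, h₃⟩ := ih
    obtain ⟨ψ, h₄, h₅, h₆⟩ := h b
    refine ⟨φ ⊓ ψ, ?_, by simp [h₂, h₅], fun b' hb' => ?_⟩
    · simp only [min, BoundedFormula.not, Bot.bot, quantifierRank]
      omega
    · rw [BoundedFormula.realize_inf]
      rcases Finset.mem_insert.1 hb' with rfl | hb'
      · exact fun h => h₆ h.2
      · exact fun h => h₃ b' hb' h.1

theorem forth_of_realize {A B : FinStruct L} (r : ℕ) : ∀ {m : ℕ} {x : Fin m → A} {y : Fin m → B},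
    (∀ φ : L.BoundedFormula Empty m, quantifierRank φ ≤ r →
      φ.Realize default x → φ.Realize default y) →
    Forth r (constantPairs A B ∪ Set.range fun i => (x i, y i)) := by
  have atomic : ∀ {m : ℕ} {x : Fin m → A} {y : Fin m → B},
      (∀ φ : L.BoundedFormula Empty m, quantifierRank φ = 0 →
        φ.Realize default x → φ.Realize default y) →
      IsPartialHom (constantPairs A B ∪ Set.range fun i => (x i, y i)) := by
    intro m x y h
    have term : ∀ p ∈ constantPairs A B ∪ Set.range fun i => (x i, y i),
        ∃ t : L.Term (Empty ⊕ Fin m), t.realize (Sum.elim default x) = p.1 ∧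
          t.realize (Sum.elim default y) = p.2 := by
      rintro _ (⟨s, rfl⟩ | ⟨i, rfl⟩)
      · exact ⟨Constants.term s, by simp, by simp⟩
      · exact ⟨.var (.inr i), rfl, rfl⟩
    refine ⟨fun p hp q hq => ?_, fun n R c hc => ?_⟩
    · obtain ⟨t, ht, ht'⟩ := term p hp
      obtain ⟨u, hu, hu'⟩ := term q hq
      rw [← ht, ← ht', ← hu, ← hu']
      exact h (.equal t u) rfl
    · choose t ht ht' using fun i => term (c i) (hc i)
      simp only [← ht, ← ht']
      exact h (.rel R t) rfl
  induction r with
  | zero => exact fun h => atomic fun φ hφ => h φ hφ.le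
  | succ r ih =>
    intro m x y h
    refine ⟨atomic fun φ hφ => h φ (by omega), fun a => ?_⟩
    -- If no `b` answers `a`, each is separated from `a` by a formula of rank at most `r`;
    -- quantifying the conjunction existentially contradicts `h`.
    by_contra! hab
    obtain ⟨φ, h₁, h₂, h₃⟩ := exists_conjunction (L := L) (r := r)
      (x := (Fin.snoc x a : Fin (m + 1) → A)) (y := fun b => (Fin.snoc y b : Fin (m + 1) → B)) fun b => by
        by_contra! hb
        refine hab b ?_
        have := ih hb
        convert this using 1
        rw [Set.insert_eq, Set.union_left_comm]
        congr 1
        ext p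
        simp only [Set.mem_union, Set.mem_singleton_iff, Set.mem_range, Fin.exists_fin_succ',
          Fin.snoc_castSucc, Fin.snoc_last]
        rw [or_comm, eq_comm]
    have := h φ.ex (by simpa [BoundedFormula.ex, BoundedFormula.not, quantifierRank] using h₁)
      (BoundedFormula.realize_ex.2 ⟨a, h₂⟩)
    obtain ⟨b, hb⟩ := BoundedFormula.realize_ex.1 this
    exact h₃ b hb

theorem forth_of_logicallyEquivalent {k : ℕ} {A B : FinStruct L} (h : LogicallyEquivalent k A B) :
    Forth k (constantPairs A B) := by
  have := forth_of_realize (A := A) (B := B) k (x := default) (y := default)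
    fun φ hφ => (h φ hφ).1
  simpa using this

/-- Following a forest order, a map of the unnamed elements into `A` can be copied to `B`. -/
theorem exists_copy_of_forth {A B : FinStruct L} {k : ℕ} {T : Set (A × B)} (hT : Forth k T)
    {U : Type} [Finite U] [PartialOrder U]
    (hchain : ∀ x y z : U, y ≤ x → z ≤ x → y ≤ z ∨ z ≤ y)
    (hcard : ∀ x : U, (Set.Iic x).ncard ≤ k) (f : U → A) :
    ∃ g : U → B, ∀ v, IsPartialHom (T ∪ (fun u => (f u, g u)) '' Set.Iic v) := by
  classical
  have := Fintype.ofFinite U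
  rcases isEmpty_or_nonempty U with hU | ⟨⟨u₀⟩⟩
  · exact ⟨isEmptyElim, isEmptyElim⟩
  obtain ⟨b₀⟩ : Nonempty B := by
    have : (Set.Iic u₀).ncard ≠ 0 := (Set.ncard_pos (Set.toFinite _)).2 ⟨u₀, Set.self_mem_Iic⟩ |>.ne'
    have := hcard u₀
    obtain ⟨k, rfl⟩ : ∃ j, k = j + 1 := ⟨k - 1, by omega⟩
    exact ⟨(hT.2 (f u₀)).choose⟩
  -- Vertices are added one at a time above their ancestors. Each branch is a separate play with `k`
  -- minus its length rounds left, so branches never compete for rounds.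
  suffices ∀ (D : Finset U), IsLowerSet (D : Set U) → ∃ g : U → B, ∀ v ∈ D,
      Forth (k - (Set.Iic v).ncard) (T ∪ (fun u => (f u, g u)) '' Set.Iic v) by
    obtain ⟨g, hg⟩ := this Finset.univ (by simpa using isLowerSet_univ)
    exact ⟨g, fun v => (hg v (Finset.mem_univ v)).isPartialHom⟩
  intro D
  induction D using Finset.strongInduction with
  | H D ih =>
    intro hD
    rcases D.eq_empty_or_nonempty with rfl | hne
    · exact ⟨fun _ => b₀, by simp⟩
    obtain ⟨v, hv⟩ := D.exists_maximal hne
    have not_le : ∀ u ∈ D.erase v, ¬ v ≤ u := fun u hu hvu =>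
      (Finset.mem_erase.1 hu).1 (le_antisymm (hv.2 (Finset.mem_of_mem_erase hu) hvu) hvu)
    obtain ⟨g, hg⟩ := ih (D.erase v) (Finset.erase_ssubset hv.1) (fun u w hwu hu => by
      rw [Finset.mem_coe] at hu ⊢
      refine Finset.mem_erase.2 ⟨?_, hD hwu (Finset.mem_of_mem_erase hu)⟩
      rintro rfl
      exact not_le u hu hwu)
    have hIic : Set.Iic v = insert v (Set.Iio v) := Set.Iio_insert.symm
    have hncard : (Set.Iic v).ncard = (Set.Iio v).ncard + 1 := by
      rw [hIic, Set.ncard_insert_of_notMem (by simp)]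
    have below : Forth (k - (Set.Iio v).ncard) (T ∪ (fun u => (f u, g u)) '' Set.Iio v) := by
      rcases (Set.Iio v).eq_empty_or_nonempty with he | hne'
      · simpa [he] using hT
      · obtain ⟨w, hw⟩ := (Set.toFinite (Set.Iio v)).exists_maximal hne'
        have hwv : w < v := hw.1
        -- `w` is the parent of `v`: ancestors form a chain.
        have : Set.Iio v = Set.Iic w := by
          ext u
          refine ⟨fun hu => ?_, fun hu => lt_of_le_of_lt hu hwv⟩
          rcases hchain v u w (le_of_lt hu) hwv.le with h | h
          · exact h
          · exact hw.2 hu h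
        rw [this]
        exact hg w (Finset.mem_erase.2 ⟨hwv.ne, hD hwv.le hv.1⟩)
    have hk := hcard v
    rw [show k - (Set.Iio v).ncard = (k - (Set.Iic v).ncard) + 1 by omega] at below
    obtain ⟨b, hb⟩ := below.2 (f v)
    have agree : ∀ S : Set U, v ∉ S →
        (fun u => (f u, Function.update g v b u)) '' S = (fun u => (f u, g u)) '' S :=
      fun S hS => Set.image_congr fun u hu => by
        rw [Function.update_of_ne (ne_of_mem_of_not_mem hu hS)]
    refine ⟨Function.update g v b, fun u hu => ?_⟩
    by_cases huv : u = v
    · subst huv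
      rw [hIic, Set.image_insert_eq, agree _ (by simp), Function.update_self, Set.union_insert,
        ← hIic]
      exact hb
    · have hu' := Finset.mem_erase.2 ⟨huv, hu⟩
      rw [agree _ (not_le u hu')]
      exact hg u hu'

theorem exists_hom_of_forth [∀ n, IsEmpty (L.Functions (n + 1))] {A B C : FinStruct L} {k : ℕ}
    (hT : Forth k (constantPairs A B)) {c : Fin 0 → C}
    (hC : TreeDepthLE ((gaifmanGraph (L := L) C).induce (unnamed C c)) k) (f : C →[L] A) :
    Nonempty (C →[L] B) := by
  classical
  obtain ⟨r, hchain, hcard, hadj⟩ := hC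
  obtain ⟨g, hg⟩ := exists_copy_of_forth hT hchain hcard fun u => f u
  have named : ∀ x : C, x ∉ unnamed C c → ∃ s : L.Constants, (s : C) = x := by
    intro x hx
    by_contra! h
    exact hx ⟨h, fun ⟨i, _⟩ => i.elim0⟩
  choose s hs using named
  let h : C → B := fun x => if hx : x ∈ unnamed C c then g ⟨x, hx⟩ else (s x hx : L.Constants)
  have h_named : ∀ x ∉ unnamed C c, (f x, h x) ∈ constantPairs A B := by
    intro x hx
    refine ⟨s x hx, Prod.ext ?_ ?_⟩
    · change ((s x hx : L.Constants) : A) = f x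
      rw [← f.map_constants, hs]
    · simp only [h, dif_neg hx]
  have h_unnamed : ∀ u : unnamed C c, h u = g u := fun u => dif_pos u.2
  refine ⟨⟨h, ?_, ?_⟩⟩
  · rintro (_ | n) t x
    · have ht : ((t : L.Constants) : C) ∉ unnamed C c := fun ht => ht.1 t rfl
      rw [funMap_eq_coe_constants, funMap_eq_coe_constants]
      exact hT.isPartialHom.1 _ (h_named _ ht) _ ⟨t, rfl⟩ (f.map_constants t)
    · exact isEmptyElim t
  · intro n R x hR
    suffices ∃ T : Set (A × B), IsPartialHom T ∧ ∀ i, (f (x i), h (x i)) ∈ T by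
      obtain ⟨T, hT, hx⟩ := this
      exact hT.2 n R (fun i => (f (x i), h (x i))) hx (f.map_rel R x hR)
    rcases {u : unnamed C c | (u : C) ∈ Set.range x}.eq_empty_or_nonempty with he | hne
    · refine ⟨_, hT.isPartialHom, fun i => h_named _ fun hi => ?_⟩
      exact Set.eq_empty_iff_forall_notMem.1 he ⟨x i, hi⟩ ⟨i, rfl⟩
    -- The unnamed entries of a related tuple are pairwise comparable, so all lie below a maximal
    -- one and the partial homomorphism along that branch covers the tuple.
    · obtain ⟨v, hv⟩ := (Set.toFinite _).exists_maximal hne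
      refine ⟨_, hg v, fun i => ?_⟩
      by_cases hi : x i ∈ unnamed C c
      · refine .inr ⟨⟨x i, hi⟩, ?_, Prod.ext rfl (h_unnamed ⟨x i, hi⟩).symm⟩
        by_cases hiv : (⟨x i, hi⟩ : unnamed C c) = v
        · exact hiv.le
        · rcases hadj ⟨x i, hi⟩ v ⟨fun h => hiv (Subtype.ext h), n, R, x, hR, ⟨i, rfl⟩, hv.1⟩
            with h | h
          · exact h
          · exact hv.2 ⟨i, rfl⟩ h
      · exact .inl (h_named _ hi)

theorem kHomotopic_of_logicallyEquivalent [∀ n, IsEmpty (L.Functions (n + 1))] {k : ℕ}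
    {A B : FinStruct L} (h : LogicallyEquivalent k A B) : KHomotopic k A B := by
  refine ⟨fun C c hC ⟨f, _⟩ => ?_, fun C c hC ⟨f, _⟩ => ?_⟩
  · exact ⟨(exists_hom_of_forth (forth_of_logicallyEquivalent h) hC f).some, fun i => i.elim0⟩
  · exact ⟨(exists_hom_of_forth (forth_of_logicallyEquivalent fun φ hφ => (h φ hφ).symm) hC f).some,
      fun i => i.elim0⟩

/-- Any linear order is a single branch whose closure is complete. -/
theorem treeDepthLE_card {V : Type} [Finite V] (G : SimpleGraph V) : TreeDepthLE G (Nat.card V) := by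
  obtain ⟨n, ⟨e⟩⟩ := Finite.exists_equiv_fin V
  let : LinearOrder V := LinearOrder.lift' e e.injective
  refine ⟨inferInstance, fun x y z _ _ => le_total y z, fun x => Set.ncard_le_card _,
    fun x y _ => le_total x y⟩

/-- Homomorphic equivalence is `k`-homotopic equivalence for all `k`. -/
theorem forall_kHomotopic_iff {A B : FinStruct L} :
    (∀ k, KHomotopic k A B) ↔ Nonempty (A ⟶ B) ∧ Nonempty (B ⟶ A) := by
  constructor
  · intro h
    have key : ∀ {A B : FinStruct L}, (∀ k, KHomTo k A Fin.elim0 B Fin.elim0) →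
        Nonempty (A ⟶ B) := fun {A B} h => by
      obtain ⟨g, _⟩ := h _ A Fin.elim0 (treeDepthLE_card _) ⟨Language.Hom.id L A, fun i => i.elim0⟩
      exact ⟨g⟩
    exact ⟨key fun k => (h k).1, key fun k => (h k).2⟩
  · rintro ⟨⟨f⟩, ⟨g⟩⟩ k
    exact ⟨fun C c _ ⟨u, _⟩ => ⟨(FinStruct.toHom f).comp u, fun i => i.elim0⟩,
      fun C c _ ⟨u, _⟩ => ⟨(FinStruct.toHom g).comp u, fun i => i.elim0⟩⟩

end FMT

/-! ### Assembling the model structures and the logical equivalences -/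

namespace FMT

open Limits

theorem exists_isHomotopyEquivalence_iff {C : Type*} [Category C] [HasFiniteLimits C]
    [HasFiniteColimits C] (X Y : C) :
    letI := HomModel.modelCategory C
    (∃ f : X ⟶ Y, IsHomotopyEquivalence f) ↔ Nonempty (X ⟶ Y) ∧ Nonempty (Y ⟶ X) :=
  ⟨fun ⟨f, hf⟩ => ⟨⟨f⟩, (HomModel.isHomotopyEquivalence_iff f).1 hf⟩,
    fun ⟨⟨f⟩, hf⟩ => ⟨f, (HomModel.isHomotopyEquivalence_iff f).2 hf⟩⟩

theorem kHomotopic_iff_logicallyEquivalent {L : FirstOrder.Language.{0, 0}}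
    [∀ n, IsEmpty (L.Functions (n + 1))] {P : ObjectProperty (FinStruct L)} {k : ℕ}
    {A B : FinStruct L} (hA : IsExtendable P k A) (hB : IsExtendable P k B) (hPA : P A)
    (hPB : P B) : KHomotopic k A B ↔ LogicallyEquivalent k A B :=
  ⟨logicallyEquivalent_of_kHomotopic hA hB hPA hPB, kHomotopic_of_logicallyEquivalent⟩

theorem exists_modelCategory_finStruct (L : FirstOrder.Language.{0, 0})
    [∀ n, IsEmpty (L.Functions (n + 1))] [Finite L.Constants] :
    ∃ M : ModelCategory (FinStruct L),
      IsHomomorphicModelStructure M ∧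
      (∀ X Y : FinStruct L,
        (∃ f : X ⟶ Y, IsHomotopyEquivalence f) ↔ ∀ k, KHomotopic k X Y) ∧
      ∀ (k : ℕ) (A B : FinStruct L), IsExtendable ⊤ k A → IsExtendable ⊤ k B →
        (KHomotopic k A B ↔ LogicallyEquivalent k A B) :=
  ⟨HomModel.modelCategory _, HomModel.isHomomorphicModelStructure _,
    fun X Y => (exists_isHomotopyEquivalence_iff X Y).trans forall_kHomotopic_iff.symm,
    fun _ _ _ hA hB => kHomotopic_iff_logicallyEquivalent hA hB trivial trivial⟩

theorem exists_modelCategory_nearStructures (L : FirstOrder.Language.{0, 0})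
    [∀ n, IsEmpty (L.Functions (n + 1))] [Finite L.Constants] (d : ℕ) :
    ∃ M : ModelCategory (nearStructures L d).FullSubcategory,
      IsHomomorphicModelStructure M ∧
      ∀ X Y : (nearStructures L d).FullSubcategory,
        (∃ f : X ⟶ Y, IsHomotopyEquivalence f) ↔ ∀ k, KHomotopic k X.obj Y.obj :=
  ⟨HomModel.modelCategory _, HomModel.isHomomorphicModelStructure _, fun X Y => by
    refine (exists_isHomotopyEquivalence_iff X Y).trans ?_
    rw [forall_kHomotopic_iff]
    exact ⟨fun ⟨⟨f⟩, ⟨g⟩⟩ => ⟨⟨f.hom⟩, ⟨g.hom⟩⟩,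
      fun ⟨⟨f⟩, ⟨g⟩⟩ => ⟨⟨ObjectProperty.homMk f⟩, ⟨ObjectProperty.homMk g⟩⟩⟩⟩

instance (σ : FirstOrder.Language.{0, 0}) [σ.IsRelational] : Finite σ.Constants :=
  inferInstanceAs (Finite (σ.Functions 0))

end FMT
theorem corollary1 (σ : FirstOrder.Language.{0, 0}) [σ.IsRelational]
    [Finite (Σ p, σ.Relations p)] (n d : ℕ) :
    -- the category of `d`-neighbourhoods of `n`-tuples
    (∃ M : ModelCategory (FMT.neighborhoods σ n d).FullSubcategory,
      FMT.IsHomomorphicModelStructure M ∧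
      (∀ X Y : (FMT.neighborhoods σ n d).FullSubcategory,
        (∃ f : X ⟶ Y, FMT.IsHomotopyEquivalence f) ↔ ∀ k, FMT.KHomotopic k X.obj Y.obj) ∧
      ∀ (k : ℕ) (A B : FMT.FinStruct σ) (a : Fin n → A) (b : Fin n → B),
        FMT.IsExtendable (FMT.neighborhoods σ n d) k (FMT.neighborhood A d a) →
        FMT.IsExtendable (FMT.neighborhoods σ n d) k (FMT.neighborhood B d b) →
        (FMT.KHomotopic k (FMT.neighborhood A d a) (FMT.neighborhood B d b) ↔
          FMT.LogicallyEquivalent k (FMT.neighborhood A d a) (FMT.neighborhood B d b))) ∧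
    -- the category `STRUCT[σ]`
    (∃ M : ModelCategory (FMT.FinStruct σ),
      FMT.IsHomomorphicModelStructure M ∧
      (∀ X Y : FMT.FinStruct σ,
        (∃ f : X ⟶ Y, FMT.IsHomotopyEquivalence f) ↔ ∀ k, FMT.KHomotopic k X Y) ∧
      ∀ (k : ℕ) (A B : FMT.FinStruct σ),
        FMT.IsExtendable ⊤ k A → FMT.IsExtendable ⊤ k B →
        (FMT.KHomotopic k A B ↔ FMT.LogicallyEquivalent k A B)) ∧
    -- the category `STRUCT[σₙ]`
    (∃ M : ModelCategory (FMT.FinStruct (σ.withConstants (Fin n))),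
      FMT.IsHomomorphicModelStructure M ∧
      (∀ X Y : FMT.FinStruct (σ.withConstants (Fin n)),
        (∃ f : X ⟶ Y, FMT.IsHomotopyEquivalence f) ↔ ∀ k, FMT.KHomotopic k X Y) ∧
      ∀ (k : ℕ) (A B : FMT.FinStruct (σ.withConstants (Fin n))),
        FMT.IsExtendable ⊤ k A → FMT.IsExtendable ⊤ k B →
        (FMT.KHomotopic k A B ↔ FMT.LogicallyEquivalent k A B)) := by
  refine ⟨?_, FMT.exists_modelCategory_finStruct σ,
    FMT.exists_modelCategory_finStruct (σ.withConstants (Fin n))⟩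
  obtain ⟨M, hM, hM'⟩ : ∃ M : ModelCategory (FMT.neighborhoods σ n d).FullSubcategory,
      FMT.IsHomomorphicModelStructure M ∧
      ∀ X Y : (FMT.neighborhoods σ n d).FullSubcategory,
        (∃ f : X ⟶ Y, FMT.IsHomotopyEquivalence f) ↔ ∀ k, FMT.KHomotopic k X.obj Y.obj := by
    rw [FMT.neighborhoods_eq]
    exact FMT.exists_modelCategory_nearStructures _ d
  exact ⟨M, hM, hM', fun k A B a b hA hB => FMT.kHomotopic_iff_logicallyEquivalent hA hB
    ⟨A, a, ⟨Iso.refl _⟩⟩ ⟨B, b, ⟨Iso.refl _⟩⟩⟩
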